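/- Identify $\mathfrak{sl}_2^*(\mathbb{R})$ with $\mathbb{R}^3$, with coordinates $x,y,z$, in such a way that its linear Poisson structure is $$\pi = x\,\partial_y\wedge\partial_z + y\,\partial_z\wedge\partial_x - z\,\partial_x\wedge\partial_y ,$$ and let $f = x^2+y^2-z^2$. Let $\mathfrak{X}^k_F = \wedge^k T_0\mathbb{R}^3\otimes\mathbb{R}[[x,y,z]]$ be the space of formal $k$-vector fields at $0$. With the differential $d_\pi = [\pi,\cdot\,]:\mathfrak{X}^k_F\to\mathfrak{X}^{k+1}_F$, where $[\cdot,\cdot]$ is the Schouten–Nijenhuis bracket, these spaces form a cochain complex. Its cohomology $H^k_F(\mathfrak{sl}_2^*(\mathbb{R}),\pi)$ is the formal Poisson cohomology at $0$. Then $$H^0_F=\mathbb{R}[[f]],\qquad H^1_F=0,\qquad H^2_F=0,\qquad H^3_F=\mathbb{R}[[f]]\otimes\partial_x\wedge\partial_y\wedge\partial_z .$$ Explicitly, the maps $g\mapsto [\,g(f)\,]$ and $g\mapsto[\,g(f)\,\partial_x\wedge\partial_y\wedge\partial_z\,]$ are well-defined $\mathbb{R}$-linear isomorphisms from the space $\mathbb{R}[[t]]$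 of formal power series in one variable onto $H^0_F$ and $H^3_F$ respectively. -/

import Mathlib

noncomputable section

namespace FormalPoisson

open Module

/-- Formal multivector fields at the origin of `ℝⁿ`: formal power series in the coordinates
`x₀, …, xₙ₋₁` with coefficients in the exterior algebra `⋀ T₀ℝⁿ`, that is `⋀ T₀ ⊗ ℝ[[T₀*]]`.
The basis vector `eᵢ` of `T₀ℝⁿ = ℝⁿ` is `∂/∂xᵢ`, and the product of this algebra is the wedge
product. -/
abbrev Multivector (n : ℕ) : Type :=
  MvPowerSeries (Fin n) (ExteriorAlgebra ℝ (Fin n → ℝ))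

/-- The constant vector field `∂/∂xᵢ`. -/
def del {n : ℕ} (i : Fin n) : Multivector n :=
  MvPowerSeries.C (ExteriorAlgebra.ι ℝ (Pi.single i (1 : ℝ)))

/-- A formal function, as a multivector field of degree `0`. -/
def ofFunction {n : ℕ} (g : MvPowerSeries (Fin n) ℝ) : Multivector n :=
  MvPowerSeries.map (algebraMap ℝ (ExteriorAlgebra ℝ (Fin n → ℝ))) g

/-- The formal multivector fields of degree `k`: all coefficients lie in `⋀ᵏ T₀ℝⁿ`. -/
def degreePart (n k : ℕ) : Submodule ℝ (Multivector n) where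
  carrier := {P | ∀ m, MvPowerSeries.coeff m P ∈ ⋀[ℝ]^k (Fin n → ℝ)}
  add_mem' hP hQ m := by
    rw [map_add]
    exact Submodule.add_mem _ (hP m) (hQ m)
  zero_mem' m := by
    rw [map_zero]
    exact Submodule.zero_mem _
  smul_mem' r P hP m := Submodule.smul_mem _ r (hP m)

/-- The linear form `dxᵢ` on `T₀ℝⁿ`. -/
abbrev dx {n : ℕ} (i : Fin n) : Dual ℝ (Fin n → ℝ) := LinearMap.proj i

/-- The left derivative `∂P/∂ξᵢ` with respect to the odd variable `ξᵢ = ∂/∂xᵢ`, that is the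
left contraction with `dxᵢ`:
`dxᵢ ⌋ (v ∧ b) = dxᵢ(v) b - v ∧ (dxᵢ ⌋ b)` for every vector `v`. -/
def leftContract {n : ℕ} (i : Fin n) (P : Multivector n) : Multivector n :=
  fun m => CliffordAlgebra.contractLeft (dx i) (MvPowerSeries.coeff m P)

/-- The right derivative `P ∂/∂ξᵢ`, that is the right contraction with `dxᵢ`:
`(b ∧ v) ⌊ dxᵢ = dxᵢ(v) b - (b ⌊ dxᵢ) ∧ v` for every vector `v`. -/
def rightContract {n : ℕ} (i : Fin n) (P : Multivector n) : Multivector n :=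
  fun m => CliffordAlgebra.contractRight (MvPowerSeries.coeff m P) (dx i)

/-- The partial derivative `∂P/∂xᵢ` of the coefficient functions of a multivector field. -/
abbrev partialD {n : ℕ} (i : Fin n) (P : Multivector n) : Multivector n :=
  MvPowerSeries.pderivFun i P

/-- The Schouten-Nijenhuis bracket in coordinates,
`[P, Q] = ∑ᵢ (P ⌊ dxᵢ) ∧ ∂Q/∂xᵢ - ∂P/∂xᵢ ∧ (dxᵢ ⌋ Q)`.
On vector fields it is the Lie bracket, `[X, g] = X(g)` for a vector field `X` and a function
`g`, and `[P, Q ∧ R] = [P, Q] ∧ R + (-1)^((p-1)q) Q ∧ [P, R]` in degrees `p`, `q`. -/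
def schouten {n : ℕ} (P Q : Multivector n) : Multivector n :=
  ∑ i, (rightContract i P * partialD i Q - partialD i P * leftContract i Q)

lemma partialD_add {n : ℕ} (i : Fin n) (P Q : Multivector n) :
    partialD i (P + Q) = partialD i P + partialD i Q :=
  MvPowerSeries.pderivFun_add P Q

lemma partialD_smul {n : ℕ} (i : Fin n) (r : ℝ) (P : Multivector n) :
    partialD i (r • P) = r • partialD i P := by
  ext m
  simp [partialD, MvPowerSeries.coeff_pderivFun]

lemma leftContract_add {n : ℕ} (i : Fin n) (P Q : Multivector n) :
    leftContract i (P + Q) = leftContract i P + leftContract i Q := by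
  ext m
  exact map_add (CliffordAlgebra.contractLeft (Q := (0 : QuadraticForm ℝ (Fin n → ℝ))) (dx i)) _ _

lemma leftContract_smul {n : ℕ} (i : Fin n) (r : ℝ) (P : Multivector n) :
    leftContract i (r • P) = r • leftContract i P := by
  ext m
  exact map_smul (CliffordAlgebra.contractLeft (Q := (0 : QuadraticForm ℝ (Fin n → ℝ))) (dx i)) _ _

/-- The Poisson differential `d_π = [π, ·]`. -/
def poissonD {n : ℕ} (π : Multivector n) : Multivector n →ₗ[ℝ] Multivector n where
  toFun := schouten π
  map_add' P Q := by
    simp only [schouten, partialD_add, leftContract_add, mul_add, ← Finset.sum_add_distrib]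
    exact Finset.sum_congr rfl fun i _ => by abel
  map_smul' r P := by
    simp only [schouten, partialD_smul, leftContract_smul, Finset.smul_sum, RingHom.id_apply,
      mul_smul_comm, smul_sub]

/-- The formal Poisson cocycles of degree `k`. -/
def cocycles {n : ℕ} (π : Multivector n) (k : ℕ) : Submodule ℝ (Multivector n) :=
  degreePart n k ⊓ LinearMap.ker (poissonD π)

/-- The formal Poisson coboundaries of degree `k`; they are zero in degree `0`. -/
def coboundaries {n : ℕ} (π : Multivector n) : ℕ → Submodule ℝ (Multivector n)
  | 0 => ⊥
  | k + 1 => (degreePart n k).map (poissonD π)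

/-- The formal Poisson cohomology at the origin in degree `k`, cocycles modulo coboundaries. -/
abbrev Cohomology {n : ℕ} (π : Multivector n) (k : ℕ) : Type :=
  cocycles π k ⧸ (coboundaries π k).submoduleOf (cocycles π k)

/-- The cohomology class of a cocycle. -/
def cohomologyClass {n : ℕ} (π : Multivector n) (k : ℕ) : cocycles π k →ₗ[ℝ] Cohomology π k :=
  Submodule.mkQ _

/-- The linear Poisson structure of `𝔰𝔩₂*(ℝ) = ℝ³`,
`π = x ∂y ∧ ∂z + y ∂z ∧ ∂x - z ∂x ∧ ∂y`, with `(x, y, z) = (x₀, x₁, x₂)`. -/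
def piSl2 : Multivector 3 :=
  MvPowerSeries.X 0 * (del 1 * del 2) + MvPowerSeries.X 1 * (del 2 * del 0)
    - MvPowerSeries.X 2 * (del 0 * del 1)

/-- The Casimir function `f = x² + y² - z²`. -/
def casimir : MvPowerSeries (Fin 3) ℝ :=
  MvPowerSeries.X 0 ^ 2 + MvPowerSeries.X 1 ^ 2 - MvPowerSeries.X 2 ^ 2

/-- The trivector field `∂x ∧ ∂y ∧ ∂z`. -/
def volume3 : Multivector 3 := del 0 * del 1 * del 2

/- The complex is well defined: `d_π` raises the degree by one and squares to zero. -/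

open MvPowerSeries

section aux
variable {n : ℕ}

lemma X_mul_comm' (i : Fin n) (P Q : Multivector n) : P * (X i * Q) = X i * (P * Q) := by
  rw [← mul_assoc, (commute_X P i).eq, mul_assoc]

lemma partialD_X_mul (i j : Fin n) (P : Multivector n) :
    partialD j (X i * P) = (if i = j then P else 0) + X i * partialD j P := by
  classical
  ext m
  simp only [partialD, coeff_pderivFun, map_add, X, coeff_monomial_mul, one_mul]
  rcases eq_or_ne i j with rfl | h
  · simp only [if_true, Finsupp.single_le_iff, Finsupp.add_apply, Finsupp.single_eq_same]
    rw [if_pos (by omega)]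
    by_cases hm : 1 ≤ m i
    · rw [if_pos hm, add_tsub_cancel_right, tsub_add_cancel_of_le (by simpa using hm)]
      simp only [Finsupp.tsub_apply, Finsupp.single_eq_same]
      rw [Nat.cast_sub hm]; push_cast; noncomm_ring
    · have : m i = 0 := by omega
      rw [if_neg hm, add_tsub_cancel_right, this]; simp
  · simp only [if_neg h, Finsupp.single_le_iff, Finsupp.add_apply, Finsupp.single_apply,
      if_neg h.symm, map_zero, zero_add, add_zero]
    by_cases hm : 1 ≤ m i
    · rw [if_pos hm, if_pos hm]
      have : m + Finsupp.single j 1 - Finsupp.single i 1 = m - Finsupp.single i 1 + Finsupp.single j 1 := by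
        ext t
        simp only [Finsupp.tsub_apply, Finsupp.add_apply, Finsupp.single_apply]
        split_ifs <;> grind
      rw [this]; simp [h]
    · rw [if_neg hm, if_neg hm, zero_mul]

lemma partialD_del_mul (i j : Fin n) (P : Multivector n) :
    partialD j (del i * P) = del i * partialD j P := by
  ext m
  simp only [partialD, coeff_pderivFun, del, coeff_C_mul, mul_assoc]

lemma partialD_comm (i j : Fin n) (P : Multivector n) :
    partialD i (partialD j P) = partialD j (partialD i P) := by
  ext m
  simp only [partialD, coeff_pderivFun]
  rw [add_right_comm]
  rcases eq_or_ne i j with rfl | h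
  · rfl
  · simp only [Finsupp.add_apply, Finsupp.single_apply, h, h.symm, if_false, mul_assoc, add_zero]
    congr 1
    exact mod_cast congrArg (Nat.cast) (Nat.mul_comm (m j + 1) (m i + 1))

lemma leftContract_X_mul (i j : Fin n) (P : Multivector n) :
    leftContract j (X i * P) = X i * leftContract j P := by
  classical
  ext m
  change CliffordAlgebra.contractLeft _ _ = _
  simp only [X, coeff_monomial_mul, one_mul]
  split_ifs
  · rfl
  · exact map_zero _

lemma leftContract_del_mul (i j : Fin n) (P : Multivector n) :
    leftContract j (del i * P) = (if i = j then P else 0) - del i * leftContract j P := by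
  ext m
  change CliffordAlgebra.contractLeft _ _ = _
  rw [map_sub, del, coeff_C_mul, coeff_C_mul]
  refine (CliffordAlgebra.contractLeft_ι_mul _ _ _ ).trans ?_
  congr 1
  rcases eq_or_ne i j with rfl | h
  · simp [dx]
  · simp [dx, h, h.symm]

lemma rightContract_X_mul (i j : Fin n) (P : Multivector n) :
    rightContract j (X i * P) = X i * rightContract j P := by
  classical
  ext m
  change CliffordAlgebra.contractRight _ _ = _
  simp only [X, coeff_monomial_mul, one_mul]
  split_ifs
  · rfl
  · simp

lemma rightContract_mul_del (i j : Fin n) (P : Multivector n) :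
    rightContract j (P * del i) = (if i = j then P else 0) - rightContract j P * del i := by
  ext m
  change CliffordAlgebra.contractRight _ _ = _
  rw [map_sub, del, coeff_mul_C, coeff_mul_C]
  refine (CliffordAlgebra.contractRight_mul_ι _ _ _ ).trans ?_
  congr 1
  rcases eq_or_ne i j with rfl | h
  · simp [dx]
  · simp [dx, h, h.symm]

lemma leftContract_del (i j : Fin n) :
    leftContract j (del i : Multivector n) = if i = j then 1 else 0 := by
  have h := leftContract_del_mul i j 1
  have h1 : leftContract j (1 : Multivector n) = 0 := by
    classical
    ext m
    change CliffordAlgebra.contractLeft _ _ = _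
    rw [coeff_one]
    split_ifs
    · exact CliffordAlgebra.contractLeft_one _ _
    · exact (CliffordAlgebra.contractLeft (Q := (0 : QuadraticForm ℝ (Fin n → ℝ))) (dx j)).map_zero
  simpa [h1] using h

lemma rightContract_del (i j : Fin n) :
    rightContract j (del i : Multivector n) = if i = j then 1 else 0 := by
  have h := rightContract_mul_del i j 1
  have h1 : rightContract j (1 : Multivector n) = 0 := by
    classical
    ext m
    change CliffordAlgebra.contractRight _ _ = _
    rw [coeff_one]
    split_ifs
    · exact CliffordAlgebra.contractRight_one _ _
    · simp
  simpa [h1] using h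

lemma rightContract_add (i : Fin n) (P Q : Multivector n) :
    rightContract i (P + Q) = rightContract i P + rightContract i Q := by
  ext m
  change CliffordAlgebra.contractRight _ _ = _
  simp
  rfl

lemma leftContract_neg (i : Fin n) (P : Multivector n) :
    leftContract i (-P) = -leftContract i P := by
  simpa using leftContract_smul i (-1) P

lemma leftContract_sub (i : Fin n) (P Q : Multivector n) :
    leftContract i (P - Q) = leftContract i P - leftContract i Q := by
  rw [sub_eq_add_neg, leftContract_add, leftContract_neg, sub_eq_add_neg]

lemma rightContract_sub (i : Fin n) (P Q : Multivector n) :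
    rightContract i (P - Q) = rightContract i P - rightContract i Q := by
  rw [eq_sub_iff_add_eq, ← rightContract_add, sub_add_cancel]

lemma partialD_sub (i : Fin n) (P Q : Multivector n) :
    partialD i (P - Q) = partialD i P - partialD i Q := by
  rw [eq_sub_iff_add_eq, ← partialD_add, sub_add_cancel]

lemma partialD_neg (i : Fin n) (P : Multivector n) :
    partialD i (-P) = -partialD i P := by
  simpa using partialD_smul i (-1) P

lemma leftContract_partialD (i j : Fin n) (P : Multivector n) :
    leftContract i (partialD j P) = partialD j (leftContract i P) := by
  ext m
  change CliffordAlgebra.contractLeft _ (coeff m (partialD j P)) = _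
  simp only [partialD, coeff_pderivFun]
  have h (x : ExteriorAlgebra ℝ (Fin n → ℝ)) :
      x * ((m j : ExteriorAlgebra ℝ (Fin n → ℝ)) + 1) = ((m j : ℝ) + 1) • x := by
    rw [Algebra.smul_def, Algebra.commutes]; simp
  rw [h, h, map_smul]
  rfl

lemma leftContract_self (i : Fin n) (P : Multivector n) :
    leftContract i (leftContract i P) = 0 := by
  ext m
  exact CliffordAlgebra.contractLeft_contractLeft _ _

lemma leftContract_comm (i j : Fin n) (P : Multivector n) :
    leftContract i (leftContract j P) = -leftContract j (leftContract i P) := by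
  ext m
  exact CliffordAlgebra.contractLeft_comm _ _ _

lemma del_mul_self (i : Fin n) : (del i * del i : Multivector n) = 0 := by
  rw [del, ← map_mul, ExteriorAlgebra.ι_sq_zero, map_zero]

lemma del_mul_comm (i j : Fin n) : (del i * del j : Multivector n) = -(del j * del i) := by
  rw [eq_neg_iff_add_eq_zero]
  refine Eq.trans ?_ ((congrArg (C (σ := Fin n)) (ExteriorAlgebra.ι_add_mul_swap
    (R := ℝ) (Pi.single i (1 : ℝ)) (Pi.single j (1 : ℝ)))).trans (map_zero _))
  simp only [del, map_add, map_mul]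

lemma del_mul_self_mul (i : Fin n) (P : Multivector n) : del i * (del i * P) = 0 := by
  rw [← mul_assoc, del_mul_self, zero_mul]

lemma del_mul_comm_mul (i j : Fin n) (P : Multivector n) :
    del i * (del j * P) = -(del j * (del i * P)) := by
  rw [← mul_assoc, del_mul_comm, neg_mul, mul_assoc]

lemma del_X_comm (i j : Fin n) (P : Multivector n) : del i * (X j * P) = X j * (del i * P) :=
  X_mul_comm' _ _ _

lemma X_comm (i j : Fin n) (P : Multivector n) : X i * (X j * P) = X j * (X i * P) :=
  X_mul_comm' _ _ _

lemma partialD_del_mul_del (i j l : Fin n) : partialD l (del i * del j : Multivector n) = 0 := by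
  rw [partialD_del_mul]
  unfold partialD del
  rw [pderivFun_C, mul_zero]

end aux

lemma poissonD_piSl2 (P : Multivector 3) : poissonD piSl2 P =
    (X 1 * (del 2 * partialD 0 P) + X 2 * (del 1 * partialD 0 P))
    + (- (X 0 * (del 2 * partialD 1 P)) - X 2 * (del 0 * partialD 1 P))
    + (X 0 * (del 1 * partialD 2 P) - X 1 * (del 0 * partialD 2 P))
    - del 1 * (del 2 * leftContract 0 P) - del 2 * (del 0 * leftContract 1 P)
    + del 0 * (del 1 * leftContract 2 P) := by
  change schouten _ _ = _
  simp only [schouten, Fin.sum_univ_three, piSl2, rightContract_sub, rightContract_add,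
    rightContract_X_mul, rightContract_mul_del, rightContract_del, partialD_add, partialD_sub,
    partialD_X_mul, partialD_del_mul_del]
  simp [mul_assoc, add_mul, sub_mul]
  noncomm_ring

lemma poissonD_poissonD_piSl2 (P : Multivector 3) : poissonD piSl2 (poissonD piSl2 P) = 0 := by
  simp only [poissonD_piSl2, partialD_add, partialD_sub, partialD_neg, partialD_X_mul,
    partialD_del_mul, leftContract_add, leftContract_sub, leftContract_neg, leftContract_X_mul,
    leftContract_del_mul, leftContract_partialD, leftContract_self, mul_add, mul_sub, mul_neg,
    del_X_comm, partialD_comm (n := 3) 1 0, partialD_comm (n := 3) 2 0, partialD_comm (n := 3) 2 1, leftContract_comm (n := 3) 1 0,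
    leftContract_comm (n := 3) 2 0, leftContract_comm (n := 3) 2 1, del_mul_self_mul, del_mul_comm_mul (n := 3) 1 0,
    del_mul_comm_mul (n := 3) 2 0, del_mul_comm_mul (n := 3) 2 1, X_comm (n := 3) 1 0, X_comm (n := 3) 2 0, X_comm (n := 3) 2 1, Fin.isValue,
    Fin.reduceEq, if_true, if_false, mul_zero, neg_zero, zero_add, add_zero, neg_neg, sub_zero,
    zero_sub]
  abel


section degree
variable {n : ℕ}

lemma contractLeft_mem (d : Module.Dual ℝ (Fin n → ℝ)) (k : ℕ) :
    ∀ x ∈ ⋀[ℝ]^(k + 1) (Fin n → ℝ),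
      CliffordAlgebra.contractLeft (Q := (0 : QuadraticForm ℝ (Fin n → ℝ))) d x ∈
        ⋀[ℝ]^k (Fin n → ℝ) := by
  induction k with
  | zero =>
    intro x hx
    rw [ExteriorAlgebra.exteriorPower, zero_add, pow_one] at hx
    obtain ⟨v, rfl⟩ := hx
    rw [show CliffordAlgebra.contractLeft (Q := (0 : QuadraticForm ℝ (Fin n → ℝ))) d
      (ExteriorAlgebra.ι ℝ v) = _ from CliffordAlgebra.contractLeft_ι _ d v,
      ExteriorAlgebra.exteriorPower, pow_zero]
    exact Submodule.algebraMap_mem _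
  | succ k ih =>
    intro x hx
    rw [ExteriorAlgebra.exteriorPower, pow_succ'] at hx
    induction hx using Submodule.mul_induction_on' with
    | mem_mul_mem m hm y hy =>
      obtain ⟨v, rfl⟩ := hm
      rw [show CliffordAlgebra.contractLeft (Q := (0 : QuadraticForm ℝ (Fin n → ℝ))) d
        (ExteriorAlgebra.ι ℝ v * y) = _ from CliffordAlgebra.contractLeft_ι_mul d v y]
      refine Submodule.sub_mem _ (Submodule.smul_mem _ _ hy) ?_
      rw [ExteriorAlgebra.exteriorPower, pow_succ']
      exact Submodule.mul_mem_mul ⟨v, rfl⟩ (ih y hy)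
    | add x _ y _ hx hy =>
      rw [map_add]
      exact Submodule.add_mem _ hx hy

lemma leftContract_mem (i : Fin n) {k : ℕ} {P : Multivector n} (hP : P ∈ degreePart n (k + 1)) :
    leftContract i P ∈ degreePart n k :=
  fun m => contractLeft_mem _ k _ (hP m)

lemma leftContract_eq_zero (i : Fin n) {P : Multivector n} (hP : P ∈ degreePart n 0) :
    leftContract i P = 0 := by
  ext m
  have h := hP m
  rw [ExteriorAlgebra.exteriorPower, pow_zero, Submodule.mem_one] at h
  obtain ⟨r, hr⟩ := h
  change CliffordAlgebra.contractLeft _ (coeff m P) = _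
  rw [← hr]
  exact CliffordAlgebra.contractLeft_algebraMap _ _ r

lemma partialD_mem (i : Fin n) {k : ℕ} {P : Multivector n} (hP : P ∈ degreePart n k) :
    partialD i P ∈ degreePart n k := by
  intro m
  rw [partialD, coeff_pderivFun]
  have h (x : ExteriorAlgebra ℝ (Fin n → ℝ)) :
      x * ((m i : ExteriorAlgebra ℝ (Fin n → ℝ)) + 1) = ((m i : ℝ) + 1) • x := by
    rw [Algebra.smul_def, Algebra.commutes]; simp
  rw [h]
  exact Submodule.smul_mem _ _ (hP _)

lemma X_mul_mem (i : Fin n) {k : ℕ} {P : Multivector n} (hP : P ∈ degreePart n k) :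
    X i * P ∈ degreePart n k := by
  classical
  intro m
  simp only [X, coeff_monomial_mul, one_mul]
  split_ifs
  · exact hP _
  · exact Submodule.zero_mem _

lemma del_mul_mem (i : Fin n) {k : ℕ} {P : Multivector n} (hP : P ∈ degreePart n k) :
    del i * P ∈ degreePart n (k + 1) := by
  intro m
  rw [del, coeff_C_mul, ExteriorAlgebra.exteriorPower, pow_succ']
  exact Submodule.mul_mem_mul ⟨_, rfl⟩ (hP m)

lemma del_mul_del_mul_leftContract_mem (i j l : Fin n) {k : ℕ} {P : Multivector n}
    (hP : P ∈ degreePart n k) : del i * (del j * leftContract l P) ∈ degreePart n (k + 1) := by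
  cases k with
  | zero => simp [leftContract_eq_zero l hP]
  | succ k => exact del_mul_mem _ (del_mul_mem _ (leftContract_mem _ hP))

end degree

lemma poissonD_piSl2_mem {k : ℕ} {P : Multivector 3} (hP : P ∈ degreePart 3 k) :
    poissonD piSl2 P ∈ degreePart 3 (k + 1) := by
  have h (i j l : Fin 3) : X i * (del j * partialD l P) ∈ degreePart 3 (k + 1) :=
    X_mul_mem _ (del_mul_mem _ (partialD_mem _ hP))
  have h' (i j l : Fin 3) := del_mul_del_mul_leftContract_mem i j l hP
  rw [poissonD_piSl2]
  exact add_mem (sub_mem (sub_mem (add_mem (add_mem (add_mem (h _ _ _) (h _ _ _))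
    (sub_mem (neg_mem (h _ _ _)) (h _ _ _))) (sub_mem (h _ _ _) (h _ _ _))) (h' _ _ _))
    (h' _ _ _)) (h' _ _ _)

/-- Coboundaries are cocycles: `(⋀• T₀ ⊗ ℝ[[T₀*]], d_π)` is a cochain complex. -/
lemma coboundaries_le_cocycles (k : ℕ) : coboundaries piSl2 k ≤ cocycles piSl2 k := by
  cases k with
  | zero => exact bot_le
  | succ k =>
    rintro _ ⟨P, hP, rfl⟩
    exact ⟨poissonD_piSl2_mem hP, poissonD_poissonD_piSl2 P⟩

end FormalPoisson

end

noncomputable section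

namespace FormalPoisson

open MvPowerSeries

/-! The complex is the Chevalley–Eilenberg complex of `𝔰𝔩₂` with values in formal functions: `rotX`,
`rotY`, `rotZ` are minus the Hamiltonian derivations of the three coordinates. As in Whitehead's
lemmas, everything rests on the Casimir operator `Ω = rotX² + rotY² - rotZ²`.

The identity `Ω = E² + E - fΔ` (`casimirOp_eq`), with `E` the Euler field and `Δ` the Laplacian,
gives `Ω a = d(d+1) a - f Δa` in degree `d`. As `Ω` commutes with `f` and with `Δ`, induction on `d`
in steps of two shows that formal functions are the direct sum of `ℝ[[f]]` and the image of `Ω`, and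
that `ker Ω = ℝ[[f]]`, which the action annihilates (`exists_eq_subst_add_casimirOp`,
`subst_eq_zero_of_eq_casimirOp`, `rot_eq_zero_of_casimirOp_eq_zero`).

Write each component of a cochain as a series in `f` plus `Ω` of something. The differential
respects this splitting. On the `Ω` part there is a homotopy `h`, contraction with the action
through the invariant form, with `d h + h d = Ω`. If `Ω α` is closed, the components of `d α` lie in
`ker Ω`, so the action kills them; hence `h d α = 0` and `Ω α = d (h α)`. On the invariant part only
the structure constants act: `d` vanishes from degrees 0 and 2 and is bijective from degree 1 to
degree 2, so that `ℝ[[f]]` survives exactly in degrees 0 and 3. -/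

/-- Formal functions at the origin of `ℝ³`. -/
abbrev FormalFunction : Type := MvPowerSeries (Fin 3) ℝ

/-! ### The `𝔰𝔩₂` action, the Euler field, the Laplacian and the Casimir operator -/

lemma pderiv_comm (i j : Fin 3) (a : FormalFunction) :
    pderiv ℝ i (pderiv ℝ j a) = pderiv ℝ j (pderiv ℝ i a) := by
  ext m
  simp only [coeff_pderiv]
  rw [add_right_comm]
  rcases eq_or_ne i j with rfl | h
  · rfl
  · simp only [Finsupp.add_apply, Finsupp.single_apply, h, h.symm, if_false, add_zero]
    ring

/-- The action of the first generator of `𝔰𝔩₂` on functions. -/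
def rotX : Derivation ℝ FormalFunction FormalFunction :=
  (X 1 : FormalFunction) • pderiv ℝ 2 + (X 2 : FormalFunction) • pderiv ℝ 1

/-- The action of the second generator of `𝔰𝔩₂` on functions. -/
def rotY : Derivation ℝ FormalFunction FormalFunction :=
  -((X 2 : FormalFunction) • pderiv ℝ 0 + (X 0 : FormalFunction) • pderiv ℝ 2)

/-- The action of the third generator of `𝔰𝔩₂` on functions. -/
def rotZ : Derivation ℝ FormalFunction FormalFunction :=
  (X 0 : FormalFunction) • pderiv ℝ 1 - (X 1 : FormalFunction) • pderiv ℝ 0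

/-- The Euler vector field. -/
def euler : Derivation ℝ FormalFunction FormalFunction :=
  (X 0 : FormalFunction) • pderiv ℝ 0 + (X 1 : FormalFunction) • pderiv ℝ 1 +
    (X 2 : FormalFunction) • pderiv ℝ 2

/-- The Laplacian of the Killing form. -/
def laplacian : FormalFunction →ₗ[ℝ] FormalFunction :=
  (pderiv ℝ 0).toLinearMap ∘ₗ (pderiv ℝ 0).toLinearMap +
    (pderiv ℝ 1).toLinearMap ∘ₗ (pderiv ℝ 1).toLinearMap -
    (pderiv ℝ 2).toLinearMap ∘ₗ (pderiv ℝ 2).toLinearMap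

/-- The action of the quadratic Casimir element on functions. -/
def casimirOp : FormalFunction →ₗ[ℝ] FormalFunction :=
  rotX.toLinearMap ∘ₗ rotX.toLinearMap + rotY.toLinearMap ∘ₗ rotY.toLinearMap -
    rotZ.toLinearMap ∘ₗ rotZ.toLinearMap

lemma rotX_apply (a : FormalFunction) :
    rotX a = X 1 * pderiv ℝ 2 a + X 2 * pderiv ℝ 1 a := rfl

lemma rotY_apply (a : FormalFunction) :
    rotY a = -(X 2 * pderiv ℝ 0 a + X 0 * pderiv ℝ 2 a) := rfl

lemma rotZ_apply (a : FormalFunction) :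
    rotZ a = X 0 * pderiv ℝ 1 a - X 1 * pderiv ℝ 0 a := by
  simp [rotZ]

lemma euler_apply (a : FormalFunction) :
    euler a = X 0 * pderiv ℝ 0 a + X 1 * pderiv ℝ 1 a + X 2 * pderiv ℝ 2 a := rfl

lemma laplacian_apply (a : FormalFunction) :
    laplacian a = pderiv ℝ 0 (pderiv ℝ 0 a) + pderiv ℝ 1 (pderiv ℝ 1 a) -
      pderiv ℝ 2 (pderiv ℝ 2 a) := rfl

lemma casimirOp_apply (a : FormalFunction) :
    casimirOp a = rotX (rotX a) + rotY (rotY a) - rotZ (rotZ a) := rfl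

lemma pderiv_X_mul (i j : Fin 3) (a : FormalFunction) :
    pderiv ℝ i (X j * a) = (if i = j then a else 0) + X j * pderiv ℝ i a := by
  rw [Derivation.leibniz, pderiv_X]
  rcases eq_or_ne i j with rfl | h
  · simp [add_comm]
  · simp [h, h.symm]

lemma rotX_rotY (a : FormalFunction) : rotX (rotY a) = rotY (rotX a) + rotZ a := by
  simp only [rotX_apply, rotY_apply, rotZ_apply, map_add, map_neg, pderiv_X_mul,
    pderiv_comm 1 0, pderiv_comm 2 0, pderiv_comm 2 1, Fin.isValue, Fin.reduceEq, if_true, if_false]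
  ring

lemma rotY_rotZ (a : FormalFunction) : rotY (rotZ a) = rotZ (rotY a) - rotX a := by
  simp only [rotX_apply, rotY_apply, rotZ_apply, map_add, map_sub, map_neg, pderiv_X_mul,
    pderiv_comm 1 0, pderiv_comm 2 0, pderiv_comm 2 1, Fin.isValue, Fin.reduceEq, if_true, if_false]
  ring

lemma rotZ_rotX (a : FormalFunction) : rotZ (rotX a) = rotX (rotZ a) - rotY a := by
  simp only [rotX_apply, rotY_apply, rotZ_apply, map_add, map_sub, pderiv_X_mul,
    pderiv_comm 1 0, pderiv_comm 2 0, pderiv_comm 2 1, Fin.isValue, Fin.reduceEq, if_true, if_false]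
  ring

/-- The Casimir element is central; this follows from the three bracket relations alone, whose signs
match the minus sign before `rotZ²`. -/
lemma casimirOp_rotX (a : FormalFunction) : casimirOp (rotX a) = rotX (casimirOp a) := by
  simp only [casimirOp_apply, map_add, map_sub, rotX_rotY, rotY_rotZ, rotZ_rotX]
  ring

lemma casimirOp_rotY (a : FormalFunction) : casimirOp (rotY a) = rotY (casimirOp a) := by
  simp only [casimirOp_apply, map_add, map_sub, rotX_rotY, rotY_rotZ, rotZ_rotX]
  ring

lemma casimirOp_rotZ (a : FormalFunction) : casimirOp (rotZ a) = rotZ (casimirOp a) := by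
  simp only [casimirOp_apply, map_add, map_sub, rotX_rotY, rotY_rotZ, rotZ_rotX]
  ring

/-- The analogue, for the form of signature `(2,1)`, of the angular momentum identity `L² = E² + E -
r²Δ`. It makes `Ω` triangular in each degree: a scalar minus a term divisible by `f`. -/
lemma casimirOp_eq (a : FormalFunction) :
    casimirOp a = euler (euler a) + euler a - casimir * laplacian a := by
  simp only [casimirOp_apply, rotX_apply, rotY_apply, rotZ_apply, euler_apply, laplacian_apply,
    casimir, map_add, map_sub, map_neg, pderiv_X_mul,
    pderiv_comm 1 0, pderiv_comm 2 0, pderiv_comm 2 1, Fin.isValue, Fin.reduceEq, if_true, if_false]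
  ring

lemma laplacian_euler (a : FormalFunction) :
    laplacian (euler a) = euler (laplacian a) + 2 * laplacian a := by
  simp only [euler_apply, laplacian_apply, map_add, map_sub, map_zero, pderiv_X_mul,
    pderiv_comm 1 0, pderiv_comm 2 0, pderiv_comm 2 1, Fin.isValue, Fin.reduceEq, if_true, if_false]
  ring

lemma laplacian_casimir_mul (a : FormalFunction) :
    laplacian (casimir * a) = 6 * a + 4 * euler a + casimir * laplacian a := by
  simp only [euler_apply, laplacian_apply, casimir, pow_two, add_mul, sub_mul, mul_assoc,
    map_add, map_sub, map_zero, pderiv_X_mul, Fin.isValue, Fin.reduceEq, if_true, if_false]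
  ring

lemma laplacian_casimirOp (a : FormalFunction) :
    laplacian (casimirOp a) = casimirOp (laplacian a) := by
  have h2 : euler (2 * laplacian a) = 2 * euler (laplacian a) := by
    rw [two_mul, map_add, two_mul]
  simp only [casimirOp_eq, map_add, map_sub, laplacian_euler, laplacian_casimir_mul, h2]
  ring

/-- The derivation kills `f`, so it is linear over multiplication by `f`; this is what makes `Ω`
linear over `f`. -/
lemma rotX_casimir_mul (a : FormalFunction) : rotX (casimir * a) = casimir * rotX a := by
  simp only [rotX_apply, casimir, pow_two, add_mul, sub_mul, mul_assoc,
    map_add, map_sub, pderiv_X_mul, Fin.isValue, Fin.reduceEq, if_true, if_false]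
  ring

lemma rotY_casimir_mul (a : FormalFunction) : rotY (casimir * a) = casimir * rotY a := by
  simp only [rotY_apply, casimir, pow_two, add_mul, sub_mul, mul_assoc,
    map_add, map_sub, pderiv_X_mul, Fin.isValue, Fin.reduceEq, if_true, if_false]
  ring

lemma rotZ_casimir_mul (a : FormalFunction) : rotZ (casimir * a) = casimir * rotZ a := by
  simp only [rotZ_apply, casimir, pow_two, add_mul, sub_mul, mul_assoc,
    map_add, map_sub, pderiv_X_mul, Fin.isValue, Fin.reduceEq, if_true, if_false]
  ring

lemma euler_casimir_mul (a : FormalFunction) :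
    euler (casimir * a) = 2 * (casimir * a) + casimir * euler a := by
  simp only [euler_apply, casimir, pow_two, add_mul, sub_mul, mul_assoc,
    map_add, map_sub, pderiv_X_mul, Fin.isValue, Fin.reduceEq, if_true, if_false]
  ring

lemma casimirOp_casimir_mul (a : FormalFunction) :
    casimirOp (casimir * a) = casimir * casimirOp a := by
  simp only [casimirOp_apply, rotX_casimir_mul, rotY_casimir_mul, rotZ_casimir_mul]
  ring

/-! ### Powers of the Casimir function, indexed by polynomial degree -/

/-- The power of the Casimir function of degree `d` (zero when `d` is odd). -/
def casimirPart : ℕ → FormalFunction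
  | 0 => 1
  | 1 => 0
  | d + 2 => casimir * casimirPart d

lemma casimirPart_zero : casimirPart 0 = 1 := rfl

lemma casimirPart_add_two (d : ℕ) : casimirPart (d + 2) = casimir * casimirPart d := rfl

lemma casimirPart_two_mul (k : ℕ) : casimirPart (2 * k) = casimir ^ k := by
  induction k with
  | zero => rfl
  | succ k ih => rw [mul_add, mul_one, casimirPart, ih, pow_succ']

lemma casimirPart_two_mul_add_one (k : ℕ) : casimirPart (2 * k + 1) = 0 := by
  induction k with
  | zero => rfl
  | succ k ih => rw [mul_add, mul_one, add_right_comm, casimirPart, ih, mul_zero]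

lemma rotX_casimirPart (d : ℕ) : rotX (casimirPart d) = 0 := by
  induction d using Nat.twoStepInduction with
  | zero => exact rotX.map_one_eq_zero
  | one => exact map_zero _
  | more d ih _ => rw [casimirPart, rotX_casimir_mul, ih, mul_zero]

lemma rotY_casimirPart (d : ℕ) : rotY (casimirPart d) = 0 := by
  induction d using Nat.twoStepInduction with
  | zero => exact rotY.map_one_eq_zero
  | one => exact map_zero _
  | more d ih _ => rw [casimirPart, rotY_casimir_mul, ih, mul_zero]

lemma rotZ_casimirPart (d : ℕ) : rotZ (casimirPart d) = 0 := by
  induction d using Nat.twoStepInduction with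
  | zero => exact rotZ.map_one_eq_zero
  | one => exact map_zero _
  | more d ih _ => rw [casimirPart, rotZ_casimir_mul, ih, mul_zero]

lemma euler_casimirPart (d : ℕ) : euler (casimirPart d) = d * casimirPart d := by
  induction d using Nat.twoStepInduction with
  | zero => simp [casimirPart]
  | one => simp [casimirPart]
  | more d ih _ =>
    rw [casimirPart, euler_casimir_mul, ih]
    push_cast
    ring

/-- The nonzero factor is what lets `Δ` detect powers of `f` and drive the descent in degree. -/
lemma laplacian_casimirPart (d : ℕ) :
    laplacian (casimirPart (d + 2)) = (((d + 2) * (d + 3) : ℝ)) • casimirPart d := by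
  have key : laplacian (casimirPart (d + 2)) = (d + 2) * (d + 3) * casimirPart d := by
    induction d using Nat.twoStepInduction with
    | zero =>
      rw [casimirPart_add_two, laplacian_casimir_mul, euler_casimirPart]
      simp [casimirPart_zero, laplacian_apply]
      norm_num
    | one => simp [casimirPart]
    | more d ih _ =>
      rw [casimirPart_add_two, laplacian_casimir_mul, ih, euler_casimirPart, casimirPart_add_two]
      push_cast
      ring
  rw [key, Algebra.smul_def]
  simp only [map_mul, map_add, map_natCast, map_ofNat]

/-! ### Homogeneous components -/

/-- Two formal functions have the same homogeneous component of degree `d`. -/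
def EqDeg (d : ℕ) (a b : FormalFunction) : Prop :=
  ∀ m : Fin 3 →₀ ℕ, m.degree = d → coeff m a = coeff m b

namespace EqDeg

variable {d : ℕ} {a b c a' b' : FormalFunction}

lemma refl (d : ℕ) (a : FormalFunction) : EqDeg d a a := fun _ _ => rfl

lemma symm (h : EqDeg d a b) : EqDeg d b a := fun m hm => (h m hm).symm

lemma trans (h : EqDeg d a b) (h' : EqDeg d b c) : EqDeg d a c :=
  fun m hm => (h m hm).trans (h' m hm)

lemma add (h : EqDeg d a b) (h' : EqDeg d a' b') : EqDeg d (a + a') (b + b') :=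
  fun m hm => by rw [map_add, map_add, h m hm, h' m hm]

lemma neg (h : EqDeg d a b) : EqDeg d (-a) (-b) :=
  fun m hm => by rw [map_neg, map_neg, h m hm]

lemma sub (h : EqDeg d a b) (h' : EqDeg d a' b') : EqDeg d (a - a') (b - b') :=
  fun m hm => by rw [map_sub, map_sub, h m hm, h' m hm]

lemma smul (r : ℝ) (h : EqDeg d a b) : EqDeg d (r • a) (r • b) :=
  fun m hm => by rw [map_smul, map_smul, h m hm]

lemma pderiv (i : Fin 3) (h : EqDeg (d + 1) a b) :
    EqDeg d (MvPowerSeries.pderiv ℝ i a) (MvPowerSeries.pderiv ℝ i b) :=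
  fun m hm => by rw [coeff_pderiv, coeff_pderiv, h _ (by simp [hm])]

lemma X_mul (i : Fin 3) (h : EqDeg d a b) : EqDeg (d + 1) (X i * a) (X i * b) := by
  classical
  intro m hm
  simp only [X, coeff_monomial_mul, one_mul]
  split_ifs with hi
  · refine h _ ?_
    have := congrArg Finsupp.degree (tsub_add_cancel_of_le hi)
    rw [map_add, Finsupp.degree_single, hm] at this
    omega
  · rfl

lemma X_mul_zero (i : Fin 3) (a : FormalFunction) : EqDeg 0 (X i * a) 0 := by
  intro m hm
  rw [Finsupp.degree_eq_zero_iff] at hm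
  subst hm
  simp

/-- The derivative loses one degree and the coordinate restores it. Degree 0 is separate: there is
nothing to lose, but both products have zero constant term. -/
lemma X_mul_pderiv (i j : Fin 3) (h : EqDeg d a b) :
    EqDeg d (X i * MvPowerSeries.pderiv ℝ j a) (X i * MvPowerSeries.pderiv ℝ j b) := by
  cases d with
  | zero => exact (X_mul_zero _ _).trans (X_mul_zero _ _).symm
  | succ d => exact (h.pderiv j).X_mul i

lemma rotX (h : EqDeg d a b) : EqDeg d (FormalPoisson.rotX a) (FormalPoisson.rotX b) := by
  simp only [rotX_apply]
  exact (h.X_mul_pderiv _ _).add (h.X_mul_pderiv _ _)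

lemma rotY (h : EqDeg d a b) : EqDeg d (FormalPoisson.rotY a) (FormalPoisson.rotY b) := by
  simp only [rotY_apply]
  exact ((h.X_mul_pderiv _ _).add (h.X_mul_pderiv _ _)).neg

lemma rotZ (h : EqDeg d a b) : EqDeg d (FormalPoisson.rotZ a) (FormalPoisson.rotZ b) := by
  simp only [rotZ_apply]
  exact (h.X_mul_pderiv _ _).sub (h.X_mul_pderiv _ _)

lemma casimirOp (h : EqDeg d a b) :
    EqDeg d (FormalPoisson.casimirOp a) (FormalPoisson.casimirOp b) :=
  (h.rotX.rotX.add h.rotY.rotY).sub h.rotZ.rotZ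

lemma laplacian (h : EqDeg (d + 2) a b) :
    EqDeg d (FormalPoisson.laplacian a) (FormalPoisson.laplacian b) :=
  (((h.pderiv 0).pderiv 0).add ((h.pderiv 1).pderiv 1)).sub ((h.pderiv 2).pderiv 2)

lemma casimir_mul (h : EqDeg d a b) : EqDeg (d + 2) (casimir * a) (casimir * b) := by
  simp only [casimir, pow_two, add_mul, sub_mul, mul_assoc]
  exact (((h.X_mul 0).X_mul 0).add ((h.X_mul 1).X_mul 1)).sub ((h.X_mul 2).X_mul 2)

lemma casimir_mul_one (a : FormalFunction) : EqDeg 1 (casimir * a) 0 := by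
  have h (i : Fin 3) : EqDeg 1 (X i * (X i * a)) 0 := by
    simpa using (X_mul_zero i a).X_mul i
  simp only [casimir, pow_two, add_mul, sub_mul, mul_assoc]
  simpa using ((h 0).add (h 1)).sub (h 2)

lemma casimir_mul_zero (a : FormalFunction) : EqDeg 0 (casimir * a) 0 := by
  have h (i : Fin 3) : EqDeg 0 (X i * (X i * a)) 0 := X_mul_zero i _
  simp only [casimir, pow_two, add_mul, sub_mul, mul_assoc]
  simpa using ((h 0).add (h 1)).sub (h 2)

/-- Each `xᵢ ∂ᵢ` multiplies the coefficient of a monomial by its exponent in `xᵢ`. -/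
lemma euler (d : ℕ) (a : FormalFunction) :
    EqDeg d (FormalPoisson.euler a) ((d : ℝ) • a) := by
  classical
  have h (i : Fin 3) (m : Fin 3 →₀ ℕ) :
      coeff m (X i * MvPowerSeries.pderiv ℝ i a) = m i * coeff m a := by
    simp only [X, coeff_monomial_mul, one_mul]
    split_ifs with hi
    · rw [coeff_pderiv, tsub_add_cancel_of_le hi, mul_comm, Finsupp.tsub_apply,
        Finsupp.single_eq_same, Nat.cast_sub (by simpa using hi i)]
      simp
    · have : m i = 0 := by
        simpa using hi
      simp [this]
  intro m hm
  rw [euler_apply, map_add, map_add, h, h, h, map_smul, ← hm, Finsupp.degree_eq_sum,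
    Fin.sum_univ_three]
  push_cast
  rw [smul_eq_mul]
  ring

lemma casimirOp_eq (d : ℕ) (a : FormalFunction) :
    EqDeg d (FormalPoisson.casimirOp a)
      ((d * (d + 1) : ℝ) • a - casimir * FormalPoisson.laplacian a) := by
  rw [FormalPoisson.casimirOp_eq]
  refine EqDeg.sub ?_ (refl _ _)
  have h := (EqDeg.euler d (FormalPoisson.euler a)).trans ((EqDeg.euler d a).smul _)
  convert h.add (EqDeg.euler d a) using 1
  module

end EqDeg

lemma eq_of_eqDeg {a b : FormalFunction} (h : ∀ d, EqDeg d a b) : a = b := by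
  ext m
  exact h _ m rfl

/-! ### Kernel and image of the Casimir operator -/

lemma eqDeg_casimirOp_zero (a : FormalFunction) : EqDeg 0 (casimirOp a) 0 := by
  have h := (EqDeg.casimirOp_eq 0 a).trans ((EqDeg.refl _ _).sub (EqDeg.casimir_mul_zero _))
  simpa using h

lemma eqDeg_casimirOp_one (a : FormalFunction) : EqDeg 1 (casimirOp a) ((2 : ℝ) • a) := by
  have h := (EqDeg.casimirOp_eq 1 a).trans ((EqDeg.refl _ _).sub (EqDeg.casimir_mul_one _))
  norm_num at h
  exact h

lemma eqDeg_zero_const (a : FormalFunction) :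
    EqDeg 0 a (coeff 0 a • casimirPart 0) := by
  intro m hm
  rw [Finsupp.degree_eq_zero_iff] at hm
  subst hm
  simp [casimirPart]

/-- In each degree, the functions are the sum of the multiples of the power of the Casimir function
and the image of the Casimir operator. -/
lemma exists_eqDeg_add_casimirOp (d : ℕ) (a : FormalFunction) :
    ∃ (c : ℝ) (u : FormalFunction), EqDeg d a (c • casimirPart d + casimirOp u) := by
  induction d using Nat.twoStepInduction generalizing a with
  | zero => exact ⟨coeff 0 a, 0, by simpa using eqDeg_zero_const a⟩
  | one =>
    refine ⟨0, (2⁻¹ : ℝ) • a, ?_⟩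
    have h := (eqDeg_casimirOp_one ((2⁻¹ : ℝ) • a)).symm
    simpa using h
  | more d ih _ =>
    obtain ⟨c, u, h⟩ := ih (laplacian a)
    set r : ℝ := ((d + 2 : ℕ) : ℝ) * (((d + 2 : ℕ) : ℝ) + 1) with hr
    have hr0 : r ≠ 0 := by positivity
    -- In degree `d + 2`, `Ω a = r a - f Δa`. Substituting `Δa = c f^(d/2) + Ω u` and moving `f`
    -- inside `Ω` gives `r a = c f^(d/2+1) + Ω (f u + a)` (for odd `d` the power is replaced by
    -- zero).
    refine ⟨r⁻¹ * c, r⁻¹ • (casimir * u + a), ?_⟩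
    have h1 := (EqDeg.casimirOp_eq (d + 2) a).trans ((EqDeg.refl _ _).sub h.casimir_mul)
    rw [← hr, mul_add, ← casimirOp_casimir_mul, mul_smul_comm, ← casimirPart_add_two] at h1
    have h2 := (h1.add (EqDeg.refl _ (c • casimirPart (d + 2) +
      casimirOp (casimir * u)))).smul r⁻¹
    rw [sub_add_cancel, inv_smul_smul₀ hr0] at h2
    convert h2.symm using 1
    simp only [map_smul, map_add]
    module

/-- In each degree, the kernel of the Casimir operator is spanned by the power of the Casimir
function. -/
lemma exists_eqDeg_of_casimirOp (d : ℕ) (a : FormalFunction) (h : EqDeg d (casimirOp a) 0) :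
    ∃ c : ℝ, EqDeg d a (c • casimirPart d) := by
  induction d using Nat.twoStepInduction generalizing a with
  | zero => exact ⟨_, eqDeg_zero_const a⟩
  | one =>
    refine ⟨0, ?_⟩
    have h2 := (((eqDeg_casimirOp_one a).symm.trans h).smul (2⁻¹ : ℝ))
    simpa using h2
  | more d ih _ =>
    -- `Δ` commutes with `Ω`, so `Δa` is again in the kernel, two degrees lower; then `r a = f Δa`
    -- recovers `a`.
    obtain ⟨c, hc⟩ := ih (laplacian a) (by simpa [laplacian_casimirOp] using h.laplacian)
    set r : ℝ := ((d + 2 : ℕ) : ℝ) * (((d + 2 : ℕ) : ℝ) + 1) with hr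
    have hr0 : r ≠ 0 := by positivity
    refine ⟨r⁻¹ * c, ?_⟩
    have h1 := (h.symm.trans (EqDeg.casimirOp_eq (d + 2) a)).trans
      ((EqDeg.refl _ _).sub hc.casimir_mul)
    rw [← hr, mul_smul_comm, ← casimirPart_add_two] at h1
    have h2 := (h1.add (EqDeg.refl _ (c • casimirPart (d + 2)))).smul r⁻¹
    rw [sub_add_cancel, inv_smul_smul₀ hr0, zero_add, smul_smul] at h2
    exact h2.symm

/-- In each degree, the kernel and the image of the Casimir operator meet in zero. -/
lemma smul_casimirPart_eq_zero (d : ℕ) (c : ℝ) (u : FormalFunction)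
    (h : EqDeg d (casimirOp u) (c • casimirPart d)) : c • casimirPart d = 0 := by
  induction d using Nat.twoStepInduction generalizing c u with
  | zero =>
    have h0 := ((eqDeg_casimirOp_zero u).symm.trans h) 0 rfl
    have hc : c = 0 := by simpa [casimirPart] using h0.symm
    rw [hc, zero_smul]
  | one => simp [casimirPart]
  | more d ih _ =>
    -- Applying `Δ` keeps the shape of the equation and lowers the degree by two. The conclusion is
    -- about the product and not about `c`, since in odd degrees `casimirPart` is zero and `c` is
    -- arbitrary.
    have h1 := h.laplacian
    rw [laplacian_casimirOp, map_smul, laplacian_casimirPart, smul_smul] at h1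
    have h2 := ih _ _ h1
    have hr0 : ((d + 2 : ℝ) * (d + 3)) ≠ 0 := by positivity
    rcases smul_eq_zero.mp h2 with h3 | h3
    · rw [(mul_eq_zero.mp h3).resolve_right hr0, zero_smul]
    · rw [casimirPart, h3, mul_zero, smul_zero]

/-! ### Power series in the Casimir function -/

lemma hasSubst_casimir : PowerSeries.HasSubst casimir :=
  PowerSeries.HasSubst.of_constantCoeff_zero (by simp [casimir])

/-- The Euler field acts by `e` on this function and by `d` on its component of degree `d`. -/
lemma eqDeg_casimirPart_of_ne {d e : ℕ} (h : d ≠ e) : EqDeg d (casimirPart e) 0 := by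
  intro m hm
  have h1 := EqDeg.euler d (casimirPart e) m hm
  rw [euler_casimirPart, ← nsmul_eq_mul, map_nsmul, map_smul, nsmul_eq_mul, smul_eq_mul] at h1
  have h2 : ((e : ℝ) - d) * coeff m (casimirPart e) = 0 := by linear_combination h1
  rw [map_zero]
  refine (mul_eq_zero.mp h2).resolve_left (sub_ne_zero.mpr ?_)
  exact_mod_cast h.symm

/-- Only the term with `2k = d` contributes. For odd `d` the rounded index `d / 2` is harmless
because `casimirPart d` is zero. -/
lemma eqDeg_subst (φ : PowerSeries ℝ) (d : ℕ) :
    EqDeg d (PowerSeries.subst casimir φ)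
      (PowerSeries.coeff (d / 2) φ • casimirPart d) := by
  intro m hm
  rw [PowerSeries.coeff_subst hasSubst_casimir, finsum_eq_single _ (d / 2), map_smul]
  · rcases Nat.even_or_odd' d with ⟨k, rfl | rfl⟩
    · rw [casimirPart_two_mul, Nat.mul_div_cancel_left _ two_pos]
    · rw [casimirPart_two_mul_add_one, ← casimirPart_two_mul,
        eqDeg_casimirPart_of_ne (by omega) m hm]
  · intro k hk
    rw [← casimirPart_two_mul]
    rcases eq_or_ne d (2 * k) with rfl | h
    · simp at hk
    · rw [eqDeg_casimirPart_of_ne h m hm, map_zero, smul_zero]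

lemma exists_eq_subst {a : FormalFunction} (h : ∀ d, ∃ c : ℝ, EqDeg d a (c • casimirPart d)) :
    ∃ φ : PowerSeries ℝ, a = PowerSeries.subst casimir φ := by
  choose c hc using h
  refine ⟨PowerSeries.mk fun k => c (2 * k), eq_of_eqDeg fun d => (hc d).trans ?_⟩
  refine EqDeg.trans ?_ (eqDeg_subst _ d).symm
  rw [PowerSeries.coeff_mk]
  rcases Nat.even_or_odd' d with ⟨k, rfl | rfl⟩
  · rw [Nat.mul_div_cancel_left _ two_pos]
    exact EqDeg.refl _ _
  · rw [casimirPart_two_mul_add_one, smul_zero, smul_zero]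
    exact EqDeg.refl _ _

/-- Every formal function is the sum of a series in the Casimir function and a function in the
image of the Casimir operator. -/
lemma exists_eq_subst_add_casimirOp (a : FormalFunction) :
    ∃ (φ : PowerSeries ℝ) (u : FormalFunction),
      a = PowerSeries.subst casimir φ + casimirOp u := by
  choose c u h using fun d => exists_eqDeg_add_casimirOp d a
  -- The degree-by-degree preimages are glued: `v` takes its component of degree `d` from `u d`, and
  -- `Ω` preserves degree.
  let v : FormalFunction := fun m => coeff m (u m.degree)
  have hv (d : ℕ) : EqDeg d v (u d) := by
    rintro m rfl
    rfl
  obtain ⟨φ, hφ⟩ := exists_eq_subst (a := a - casimirOp v) fun d => ⟨c d, by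
    have h1 := (h d).sub (hv d).casimirOp
    rwa [add_sub_cancel_right] at h1⟩
  exact ⟨φ, v, by rw [← hφ, sub_add_cancel]⟩

lemma exists_eq_subst_of_casimirOp_eq_zero {a : FormalFunction} (h : casimirOp a = 0) :
    ∃ φ : PowerSeries ℝ, a = PowerSeries.subst casimir φ :=
  exists_eq_subst fun d => exists_eqDeg_of_casimirOp d a (h ▸ EqDeg.refl _ _)

lemma subst_eq_zero_of_eq_casimirOp {φ : PowerSeries ℝ} {u : FormalFunction}
    (h : PowerSeries.subst casimir φ = casimirOp u) : PowerSeries.subst casimir φ = 0 :=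
  eq_of_eqDeg fun d => (eqDeg_subst φ d).trans <| by
    rw [smul_casimirPart_eq_zero d _ u (h ▸ eqDeg_subst φ d)]
    exact EqDeg.refl _ _

lemma rotX_subst (φ : PowerSeries ℝ) : rotX (PowerSeries.subst casimir φ) = 0 :=
  eq_of_eqDeg fun d => (eqDeg_subst φ d).rotX.trans <| by
    rw [Derivation.map_smul, rotX_casimirPart, smul_zero]
    exact EqDeg.refl _ _

lemma rotY_subst (φ : PowerSeries ℝ) : rotY (PowerSeries.subst casimir φ) = 0 :=
  eq_of_eqDeg fun d => (eqDeg_subst φ d).rotY.trans <| by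
    rw [Derivation.map_smul, rotY_casimirPart, smul_zero]
    exact EqDeg.refl _ _

lemma rotZ_subst (φ : PowerSeries ℝ) : rotZ (PowerSeries.subst casimir φ) = 0 :=
  eq_of_eqDeg fun d => (eqDeg_subst φ d).rotZ.trans <| by
    rw [Derivation.map_smul, rotZ_casimirPart, smul_zero]
    exact EqDeg.refl _ _

/-- The Laplacian of `f` is the constant 6. -/
lemma casimir_ne_zero : casimir ≠ 0 := by
  intro h
  have h1 := laplacian_casimirPart 0
  have h2 : casimirPart 2 = 0 := by rw [casimirPart, h, zero_mul]
  rw [zero_add, h2, map_zero] at h1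
  have h3 := congrArg (coeff 0) h1
  norm_num [casimirPart] at h3

lemma eq_zero_of_subst_eq_zero {φ : PowerSeries ℝ}
    (h : PowerSeries.subst casimir φ = 0) : φ = 0 := by
  ext k
  have h1 : PowerSeries.coeff k φ • casimirPart (2 * k) = 0 := by
    -- Zero is `Ω 0`, so directness of the sum applies to the vanishing component.
    refine smul_casimirPart_eq_zero _ _ 0 ?_
    have h2 := eqDeg_subst φ (2 * k)
    rw [Nat.mul_div_cancel_left _ two_pos, h] at h2
    simpa using h2
  rw [casimirPart_two_mul] at h1
  simpa using (smul_eq_zero.mp h1).resolve_right (pow_ne_zero k casimir_ne_zero)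

/-! ### Multivector fields in components -/

section coordinates

variable {n : ℕ}

lemma ofFunction_add (a b : MvPowerSeries (Fin n) ℝ) :
    ofFunction (a + b) = ofFunction a + ofFunction b := map_add _ _ _

lemma ofFunction_sub (a b : MvPowerSeries (Fin n) ℝ) :
    ofFunction (a - b) = ofFunction a - ofFunction b := map_sub _ _ _

lemma ofFunction_neg (a : MvPowerSeries (Fin n) ℝ) : ofFunction (-a) = -ofFunction a :=
  map_neg _ _

lemma ofFunction_X_mul (i : Fin n) (a : MvPowerSeries (Fin n) ℝ) :
    ofFunction (X i * a) = X i * ofFunction a := by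
  simp [ofFunction]

lemma ofFunction_smul (r : ℝ) (a : MvPowerSeries (Fin n) ℝ) :
    ofFunction (r • a) = r • ofFunction a := by
  ext m
  exact map_smul (Algebra.linearMap ℝ (ExteriorAlgebra ℝ (Fin n → ℝ))) r (coeff m a)

lemma partialD_ofFunction (i : Fin n) (a : MvPowerSeries (Fin n) ℝ) :
    partialD i (ofFunction a) = ofFunction (pderiv ℝ i a) := by
  ext m
  simp [ofFunction, partialD, coeff_pderivFun, coeff_pderiv]

lemma ofFunction_mul_del (i : Fin n) (a : MvPowerSeries (Fin n) ℝ) :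
    ofFunction a * del i = del i * ofFunction a := by
  ext m
  rw [del, coeff_mul_C, coeff_C_mul, ofFunction, coeff_map, Algebra.commutes]

lemma ofFunction_mem (a : MvPowerSeries (Fin n) ℝ) : ofFunction a ∈ degreePart n 0 := by
  intro m
  rw [ofFunction, coeff_map, ExteriorAlgebra.exteriorPower, pow_zero]
  exact Submodule.algebraMap_mem _

lemma leftContract_ofFunction (i : Fin n) (a : MvPowerSeries (Fin n) ℝ) :
    leftContract i (ofFunction a) = 0 :=
  leftContract_eq_zero i (ofFunction_mem a)

lemma eq_zero_of_ofFunction_eq_zero {a : MvPowerSeries (Fin n) ℝ} (h : ofFunction a = 0) :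
    a = 0 := by
  ext m
  have h1 := congrArg (coeff m) h
  rw [ofFunction, coeff_map, map_zero] at h1
  simpa using h1

lemma exists_eq_ofFunction {P : Multivector n} (hP : P ∈ degreePart n 0) :
    ∃ a, P = ofFunction a := by
  have h (m) : ∃ r : ℝ, algebraMap ℝ _ r = coeff m P := by
    have := hP m
    rw [ExteriorAlgebra.exteriorPower, pow_zero, Submodule.mem_one] at this
    exact this
  choose a ha using h
  exact ⟨a, by ext m; exact (ha m).symm⟩

/-- Euler's formula for the exterior degree. -/
lemma sum_ι_mul_contractLeft (k : ℕ) : ∀ x ∈ ⋀[ℝ]^k (Fin n → ℝ),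
    ∑ i, ExteriorAlgebra.ι ℝ (Pi.single i (1 : ℝ)) *
      CliffordAlgebra.contractLeft (Q := (0 : QuadraticForm ℝ (Fin n → ℝ))) (dx i) x
      = (k : ℝ) • x := by
  induction k with
  | zero =>
    intro x hx
    rw [ExteriorAlgebra.exteriorPower, pow_zero, Submodule.mem_one] at hx
    obtain ⟨r, rfl⟩ := hx
    rw [Nat.cast_zero, zero_smul]
    refine Finset.sum_eq_zero fun i _ => ?_
    rw [show CliffordAlgebra.contractLeft (Q := (0 : QuadraticForm ℝ (Fin n → ℝ))) (dx i)
      (algebraMap ℝ (ExteriorAlgebra ℝ (Fin n → ℝ)) r) = 0 from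
      CliffordAlgebra.contractLeft_algebraMap _ _ r, mul_zero]
  | succ k ih =>
    intro x hx
    rw [ExteriorAlgebra.exteriorPower, pow_succ'] at hx
    induction hx using Submodule.mul_induction_on' with
    | mem_mul_mem m hm y hy =>
      obtain ⟨v, rfl⟩ := hm
      have h1 (i : Fin n) : CliffordAlgebra.contractLeft
          (Q := (0 : QuadraticForm ℝ (Fin n → ℝ))) (dx i) (ExteriorAlgebra.ι ℝ v * y) =
          v i • y - ExteriorAlgebra.ι ℝ v * CliffordAlgebra.contractLeft
            (Q := (0 : QuadraticForm ℝ (Fin n → ℝ))) (dx i) y :=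
        CliffordAlgebra.contractLeft_ι_mul (dx i) v y
      have h2 (w : Fin n → ℝ) (z : ExteriorAlgebra ℝ (Fin n → ℝ)) :
          ExteriorAlgebra.ι ℝ w * (ExteriorAlgebra.ι ℝ v * z) =
          -(ExteriorAlgebra.ι ℝ v * (ExteriorAlgebra.ι ℝ w * z)) := by
        rw [← mul_assoc, ← mul_assoc, ← neg_mul, eq_neg_of_add_eq_zero_left
          (ExteriorAlgebra.ι_add_mul_swap (R := ℝ) w v)]
      have h3 : ∑ i, v i • ExteriorAlgebra.ι ℝ (Pi.single i (1 : ℝ)) =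
          ExteriorAlgebra.ι ℝ v := by
        simp only [← map_smul, ← map_sum]
        congr 1
        ext j
        simp [Finset.sum_apply, Pi.single_apply]
      simp only [h1, mul_sub, h2, sub_neg_eq_add, Finset.sum_add_distrib, mul_smul_comm,
        ← smul_mul_assoc]
      rw [← Finset.sum_mul, h3, ← Finset.mul_sum, ih y hy, mul_smul_comm,
        Nat.cast_succ, add_smul, one_smul, add_mul, smul_mul_assoc, add_comm]
    | add x _ y _ hx hy =>
      simp only [map_add, mul_add, Finset.sum_add_distrib, hx, hy, smul_add]

lemma sum_del_mul_leftContract {k : ℕ} {P : Multivector n} (hP : P ∈ degreePart n k) :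
    ∑ i, del i * leftContract i P = (k : ℝ) • P := by
  ext m
  rw [map_sum]
  refine Eq.trans ?_ (sum_ι_mul_contractLeft k _ (hP m))
  refine Finset.sum_congr rfl fun i _ => ?_
  rw [del, coeff_C_mul]
  rfl

end coordinates

/-- The vector field with the given components. -/
def vectorField (a b c : FormalFunction) : Multivector 3 :=
  del 0 * ofFunction a + del 1 * ofFunction b + del 2 * ofFunction c

/-- The bivector field with the given components on `∂y ∧ ∂z`, `∂z ∧ ∂x`, `∂x ∧ ∂y`. -/
def bivectorField (a b c : FormalFunction) : Multivector 3 :=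
  del 1 * (del 2 * ofFunction a) + del 2 * (del 0 * ofFunction b) +
    del 0 * (del 1 * ofFunction c)

/-- The trivector field with the given component on `∂x ∧ ∂y ∧ ∂z`. -/
def trivectorField (a : FormalFunction) : Multivector 3 :=
  del 0 * (del 1 * (del 2 * ofFunction a))

lemma ofFunction_mul_volume3 (a : FormalFunction) :
    ofFunction a * volume3 = trivectorField a := by
  rw [volume3, trivectorField, ← mul_assoc, ← mul_assoc, ofFunction_mul_del, mul_assoc (del 0),
    ofFunction_mul_del, mul_assoc, mul_assoc, ofFunction_mul_del]

lemma vectorField_mem (a b c : FormalFunction) : vectorField a b c ∈ degreePart 3 1 :=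
  add_mem (add_mem (del_mul_mem _ (ofFunction_mem _)) (del_mul_mem _ (ofFunction_mem _)))
    (del_mul_mem _ (ofFunction_mem _))

lemma bivectorField_mem (a b c : FormalFunction) : bivectorField a b c ∈ degreePart 3 2 :=
  add_mem (add_mem (del_mul_mem _ (del_mul_mem _ (ofFunction_mem _)))
    (del_mul_mem _ (del_mul_mem _ (ofFunction_mem _))))
    (del_mul_mem _ (del_mul_mem _ (ofFunction_mem _)))

lemma trivectorField_mem (a : FormalFunction) : trivectorField a ∈ degreePart 3 3 :=
  del_mul_mem _ (del_mul_mem _ (del_mul_mem _ (ofFunction_mem _)))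

lemma exists_eq_vectorField {P : Multivector 3} (hP : P ∈ degreePart 3 1) :
    ∃ a b c, P = vectorField a b c := by
  choose a ha using fun i => exists_eq_ofFunction (leftContract_mem i hP)
  have h := sum_del_mul_leftContract hP
  rw [Nat.cast_one, one_smul, Fin.sum_univ_three, ha, ha, ha] at h
  exact ⟨_, _, _, h.symm⟩

lemma exists_eq_bivectorField {P : Multivector 3} (hP : P ∈ degreePart 3 2) :
    ∃ a b c, P = bivectorField a b c := by
  choose a b c ha using fun i => exists_eq_vectorField (leftContract_mem i hP)
  have h := sum_del_mul_leftContract hP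
  rw [Fin.sum_univ_three, ha, ha, ha] at h
  -- Euler's formula yields `2 P`: each component of a bivector is seen by two contractions, with
  -- opposite signs.
  refine ⟨(2⁻¹ : ℝ) • (c 1 - b 2), (2⁻¹ : ℝ) • (a 2 - c 0), (2⁻¹ : ℝ) • (b 0 - a 1), ?_⟩
  rw [← inv_smul_smul₀ (two_ne_zero (α := ℝ)) P, ← Nat.cast_ofNat (R := ℝ) (n := 2), ← h]
  simp only [vectorField, bivectorField, mul_add, del_mul_self_mul, ofFunction_smul,
    ofFunction_sub, mul_smul_comm, mul_sub, ← smul_add, del_mul_comm_mul (n := 3) 1 0,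
    del_mul_comm_mul (n := 3) 2 0, del_mul_comm_mul (n := 3) 2 1]
  congr 1
  abel

lemma exists_eq_trivectorField {P : Multivector 3} (hP : P ∈ degreePart 3 3) :
    ∃ a, P = trivectorField a := by
  choose a b c ha using fun i => exists_eq_bivectorField (leftContract_mem i hP)
  have h := sum_del_mul_leftContract hP
  rw [Fin.sum_univ_three, ha, ha, ha] at h
  refine ⟨(3⁻¹ : ℝ) • (a 0 + b 1 + c 2), ?_⟩
  rw [← inv_smul_smul₀ (three_ne_zero (α := ℝ)) P, ← Nat.cast_ofNat (R := ℝ) (n := 3), ← h]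
  simp only [trivectorField, bivectorField, mul_add, del_mul_self_mul, ofFunction_smul,
    ofFunction_add, mul_smul_comm, mul_zero, mul_neg, del_mul_comm_mul (n := 3) 1 0,
    del_mul_comm_mul (n := 3) 2 0, del_mul_comm_mul (n := 3) 2 1]
  congr 1
  abel

lemma vectorField_eq_zero {a b c : FormalFunction} (h : vectorField a b c = 0) :
    a = 0 ∧ b = 0 ∧ c = 0 := by
  have h0 (i : Fin 3) : leftContract i (0 : Multivector 3) = 0 :=
    leftContract_eq_zero i (zero_mem _)
  refine ⟨?_, ?_, ?_⟩ <;> apply eq_zero_of_ofFunction_eq_zero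
  · simpa [vectorField, leftContract_add, leftContract_del_mul, leftContract_ofFunction, h0]
      using congrArg (leftContract 0) h
  · simpa [vectorField, leftContract_add, leftContract_del_mul, leftContract_ofFunction, h0]
      using congrArg (leftContract 1) h
  · simpa [vectorField, leftContract_add, leftContract_del_mul, leftContract_ofFunction, h0]
      using congrArg (leftContract 2) h

lemma bivectorField_eq_zero {a b c : FormalFunction} (h : bivectorField a b c = 0) :
    a = 0 ∧ b = 0 ∧ c = 0 := by
  have h0 (i : Fin 3) : leftContract i (0 : Multivector 3) = 0 :=
    leftContract_eq_zero i (zero_mem _)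
  refine ⟨?_, ?_, ?_⟩ <;> apply eq_zero_of_ofFunction_eq_zero
  · simpa [bivectorField, leftContract_add, leftContract_neg, leftContract_del_mul,
      leftContract_ofFunction, h0] using congrArg (leftContract 2) (congrArg (leftContract 1) h)
  · simpa [bivectorField, leftContract_add, leftContract_neg, leftContract_del_mul,
      leftContract_ofFunction, h0] using congrArg (leftContract 0) (congrArg (leftContract 2) h)
  · simpa [bivectorField, leftContract_add, leftContract_neg, leftContract_del_mul,
      leftContract_ofFunction, h0] using congrArg (leftContract 1) (congrArg (leftContract 0) h)

lemma trivectorField_injective : Function.Injective trivectorField := by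
  intro a b h
  rw [← sub_eq_zero]
  apply eq_zero_of_ofFunction_eq_zero
  rw [ofFunction_sub, sub_eq_zero]
  simpa [trivectorField, leftContract_sub, leftContract_del_mul, leftContract_ofFunction] using
    congrArg (leftContract 2) (congrArg (leftContract 1) (congrArg (leftContract 0) h))

/-! ### The Poisson differential in components -/

lemma poissonD_ofFunction (a : FormalFunction) :
    poissonD piSl2 (ofFunction a) = vectorField (-rotX a) (-rotY a) (-rotZ a) := by
  simp only [poissonD_piSl2, vectorField, partialD_ofFunction, leftContract_ofFunction,
    rotX_apply, rotY_apply, rotZ_apply, ofFunction_add, ofFunction_sub, ofFunction_neg,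
    ofFunction_X_mul, mul_add, mul_sub, mul_neg, del_X_comm, mul_zero]
  abel

/-- The terms `-a`, `-b`, `+c` without derivatives come from differentiating the linear coefficients
of `π`: they are the structure constants, and all that remains of `d` on invariant components. -/
lemma poissonD_vectorField (a b c : FormalFunction) :
    poissonD piSl2 (vectorField a b c) = bivectorField (rotZ b - rotY c - a)
      (rotX c - rotZ a - b) (rotY a - rotX b + c) := by
  simp only [poissonD_piSl2, vectorField, bivectorField, partialD_add, partialD_del_mul,
    partialD_ofFunction, leftContract_add, leftContract_del_mul, leftContract_ofFunction,
    rotX_apply, rotY_apply, rotZ_apply, ofFunction_add, ofFunction_sub, ofFunction_neg,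
    ofFunction_X_mul, mul_add, mul_sub, mul_neg, del_X_comm, mul_zero, del_mul_self_mul,
    del_mul_comm_mul (n := 3) 1 0, del_mul_comm_mul (n := 3) 2 0, del_mul_comm_mul (n := 3) 2 1,
    Fin.isValue, Fin.reduceEq, if_true, if_false]
  abel

lemma poissonD_bivectorField (a b c : FormalFunction) :
    poissonD piSl2 (bivectorField a b c) = trivectorField (-(rotX a + rotY b + rotZ c)) := by
  simp only [poissonD_piSl2, bivectorField, trivectorField, partialD_add, partialD_del_mul,
    partialD_ofFunction, leftContract_add, leftContract_neg, partialD_neg, leftContract_del_mul,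
    leftContract_ofFunction,
    rotX_apply, rotY_apply, rotZ_apply, ofFunction_add, ofFunction_sub, ofFunction_neg,
    ofFunction_X_mul, mul_add, mul_sub, mul_neg, del_X_comm, mul_zero, del_mul_self_mul,
    del_mul_comm_mul (n := 3) 1 0, del_mul_comm_mul (n := 3) 2 0, del_mul_comm_mul (n := 3) 2 1,
    Fin.isValue, Fin.reduceEq, if_true, if_false]
  abel

lemma poissonD_trivectorField (a : FormalFunction) :
    poissonD piSl2 (trivectorField a) = 0 := by
  simp only [poissonD_piSl2, trivectorField, partialD_del_mul,
    partialD_ofFunction, leftContract_del_mul,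
    leftContract_ofFunction, mul_sub, mul_neg, mul_zero, del_mul_self_mul,
    del_mul_comm_mul (n := 3) 1 0, del_mul_comm_mul (n := 3) 2 0, del_mul_comm_mul (n := 3) 2 1,
    Fin.isValue, Fin.reduceEq, if_true, if_false]
  abel

/-! ### Cocycles and coboundaries in each degree -/

lemma rot_eq_zero_of_casimirOp_eq_zero {a : FormalFunction} (h : casimirOp a = 0) :
    rotX a = 0 ∧ rotY a = 0 ∧ rotZ a = 0 := by
  obtain ⟨φ, rfl⟩ := exists_eq_subst_of_casimirOp_eq_zero h
  exact ⟨rotX_subst φ, rotY_subst φ, rotZ_subst φ⟩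

/-- A series in the Casimir function and a function in the image of the Casimir operator have zero
sum only if both vanish. -/
lemma eq_zero_of_subst_add_casimirOp {φ : PowerSeries ℝ} {u : FormalFunction}
    (h : PowerSeries.subst casimir φ + casimirOp u = 0) :
    PowerSeries.subst casimir φ = 0 ∧ casimirOp u = 0 := by
  have h1 : PowerSeries.subst casimir φ = 0 := by
    refine subst_eq_zero_of_eq_casimirOp (u := -u) ?_
    rw [map_neg, eq_neg_of_add_eq_zero_left h]
  exact ⟨h1, by rwa [h1, zero_add] at h⟩

lemma ofFunction_subst_mem_cocycles (φ : PowerSeries ℝ) :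
    ofFunction (PowerSeries.subst casimir φ) ∈ cocycles piSl2 0 := by
  refine ⟨ofFunction_mem _, ?_⟩
  rw [SetLike.mem_coe, LinearMap.mem_ker, poissonD_ofFunction, rotX_subst, rotY_subst, rotZ_subst]
  simp [vectorField, ofFunction]

lemma trivectorField_mem_cocycles (a : FormalFunction) :
    trivectorField a ∈ cocycles piSl2 3 :=
  ⟨trivectorField_mem a, poissonD_trivectorField a⟩

/-- Formal cocycles of degree zero are series in the Casimir function. -/
lemma exists_eq_ofFunction_subst {P : Multivector 3} (hP : P ∈ cocycles piSl2 0) :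
    ∃ φ : PowerSeries ℝ, P = ofFunction (PowerSeries.subst casimir φ) := by
  obtain ⟨a, rfl⟩ := exists_eq_ofFunction hP.1
  have h := hP.2
  rw [SetLike.mem_coe, LinearMap.mem_ker, poissonD_ofFunction] at h
  obtain ⟨hx, hy, hz⟩ := vectorField_eq_zero h
  rw [neg_eq_zero] at hx hy hz
  obtain ⟨φ, rfl⟩ := exists_eq_subst_of_casimirOp_eq_zero (a := a) (by
    simp [casimirOp_apply, hx, hy, hz])
  exact ⟨φ, rfl⟩

/-- Formal Poisson vector fields are Hamiltonian. -/
lemma cocycles_one_le : cocycles piSl2 1 ≤ coboundaries piSl2 1 := by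
  rintro P ⟨hP, hd⟩
  obtain ⟨a, b, c, rfl⟩ := exists_eq_vectorField hP
  rw [SetLike.mem_coe, LinearMap.mem_ker, poissonD_vectorField] at hd
  obtain ⟨ha, hb, hc⟩ := bivectorField_eq_zero hd
  obtain ⟨φ, u, rfl⟩ := exists_eq_subst_add_casimirOp a
  obtain ⟨χ, v, rfl⟩ := exists_eq_subst_add_casimirOp b
  obtain ⟨ψ, w, rfl⟩ := exists_eq_subst_add_casimirOp c
  simp only [map_add, rotX_subst, rotY_subst, rotZ_subst, zero_add, ← casimirOp_rotX,
    ← casimirOp_rotY, ← casimirOp_rotZ] at ha hb hc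
  -- Each cocycle equation, up to sign, is a series in `f` plus a value of `Ω`. Directness kills the
  -- series and leaves a function in `ker Ω`, hence invariant.
  obtain ⟨hφ, ha⟩ := eq_zero_of_subst_add_casimirOp (φ := φ) (u := rotY w - rotZ v + u) (by
    simp only [map_add, map_sub]; linear_combination -ha)
  obtain ⟨hχ, hb⟩ := eq_zero_of_subst_add_casimirOp (φ := χ) (u := rotZ u - rotX w + v) (by
    simp only [map_add, map_sub]; linear_combination -hb)
  obtain ⟨hψ, hc⟩ := eq_zero_of_subst_add_casimirOp (φ := ψ) (u := rotY u - rotX v + w) (by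
    simp only [map_add, map_sub]; linear_combination hc)
  obtain ⟨hax, hay, haz⟩ := rot_eq_zero_of_casimirOp_eq_zero ha
  obtain ⟨hbx, hby, hbz⟩ := rot_eq_zero_of_casimirOp_eq_zero hb
  obtain ⟨hcx, hcy, hcz⟩ := rot_eq_zero_of_casimirOp_eq_zero hc
  simp only [map_add, map_sub] at hax hay haz hbx hby hbz hcx hcy hcz
  -- The homotopy applied to `(u, v, w)`; the signs are those of the invariant form. The error `h d`
  -- consists of the action on the invariant functions just found, so it vanishes.
  refine ⟨ofFunction (-(rotX u + rotY v - rotZ w)), ofFunction_mem _, ?_⟩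
  rw [poissonD_ofFunction, hφ, hχ, hψ]
  congr 1 <;> simp only [zero_add, map_neg, neg_neg, casimirOp_apply, map_add, map_sub]
  · linear_combination -hcy + hbz + rotX_rotY v + rotZ_rotX w
  · linear_combination hcx - haz - rotX_rotY u - rotY_rotZ w
  · linear_combination - hay + hbx + rotZ_rotX u - rotY_rotZ v

/-- Formal infinitesimal deformations of the Poisson structure are trivial. -/
lemma cocycles_two_le : cocycles piSl2 2 ≤ coboundaries piSl2 2 := by
  rintro P ⟨hP, hd⟩
  obtain ⟨a, b, c, rfl⟩ := exists_eq_bivectorField hP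
  rw [SetLike.mem_coe, LinearMap.mem_ker, poissonD_bivectorField] at hd
  have h := trivectorField_injective (hd.trans (by simp [trivectorField, ofFunction] :
    (0 : Multivector 3) = trivectorField 0))
  obtain ⟨φ, u, rfl⟩ := exists_eq_subst_add_casimirOp a
  obtain ⟨χ, v, rfl⟩ := exists_eq_subst_add_casimirOp b
  obtain ⟨ψ, w, rfl⟩ := exists_eq_subst_add_casimirOp c
  simp only [map_add, rotX_subst, rotY_subst, rotZ_subst, zero_add, ← casimirOp_rotX,
    ← casimirOp_rotY, ← casimirOp_rotZ] at h
  obtain ⟨hx, hy, hz⟩ := rot_eq_zero_of_casimirOp_eq_zero (a := rotX u + rotY v + rotZ w) (by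
    simp only [map_add]; linear_combination -h)
  simp only [map_add] at hx hy hz
  -- The terms in `u`, `v`, `w` are the homotopy. The series enter with signs `-`, `-`, `+` because
  -- `d` sends invariant components `(p, q, r)` to `(-p, -q, r)`.
  refine ⟨vectorField (rotY w + rotZ v - PowerSeries.subst casimir φ)
    (-(rotX w + rotZ u) - PowerSeries.subst casimir χ)
    (rotX v - rotY u + PowerSeries.subst casimir ψ), vectorField_mem _ _ _, ?_⟩
  rw [poissonD_vectorField]
  congr 1 <;> simp only [map_neg, casimirOp_apply, map_add, map_sub, rotX_subst, rotY_subst,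
    rotZ_subst]
  · linear_combination - hx + rotX_rotY v - rotZ_rotX w
  · linear_combination - hy - rotX_rotY u + rotY_rotZ w
  · linear_combination hz - rotZ_rotX u + rotY_rotZ v

/-- In top degree the homotopy identity reduces to `d h = Ω`. -/
lemma trivectorField_casimirOp_mem (u : FormalFunction) :
    trivectorField (casimirOp u) ∈ coboundaries piSl2 3 := by
  refine ⟨bivectorField (-rotX u) (-rotY u) (rotZ u), bivectorField_mem _ _ _, ?_⟩
  rw [poissonD_bivectorField, casimirOp_apply, map_neg, map_neg]
  congr 1
  ring

/-- The action kills the series part of each component and commutes with `Ω`, so every coboundary in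
top degree has its coefficient in the image of `Ω`, which meets `ℝ[[f]]` in zero. -/
lemma eq_zero_of_trivectorField_subst_mem {φ : PowerSeries ℝ}
    (h : trivectorField (PowerSeries.subst casimir φ) ∈ coboundaries piSl2 3) : φ = 0 := by
  obtain ⟨P, hP, h⟩ := h
  obtain ⟨a, b, c, rfl⟩ := exists_eq_bivectorField hP
  rw [poissonD_bivectorField] at h
  have h := trivectorField_injective h
  obtain ⟨χ₀, u, rfl⟩ := exists_eq_subst_add_casimirOp a
  obtain ⟨χ₁, v, rfl⟩ := exists_eq_subst_add_casimirOp b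
  obtain ⟨χ₂, w, rfl⟩ := exists_eq_subst_add_casimirOp c
  simp only [map_add, rotX_subst, rotY_subst, rotZ_subst, zero_add, ← casimirOp_rotX,
    ← casimirOp_rotY, ← casimirOp_rotZ] at h
  refine eq_zero_of_subst_eq_zero (subst_eq_zero_of_eq_casimirOp
    (u := -(rotX u + rotY v + rotZ w)) ?_)
  simp only [map_neg, map_add]
  exact h.symm

/-! ### The isomorphisms in degrees 0 and 3 -/

/-- The substitution of the Casimir function, as a linear map. -/
def substCasimir : PowerSeries ℝ →ₗ[ℝ] FormalFunction where
  toFun := PowerSeries.subst casimir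
  map_add' := PowerSeries.subst_add hasSubst_casimir
  map_smul' := PowerSeries.subst_smul hasSubst_casimir

/-- The class of a series in the Casimir function. -/
def casimirClass : PowerSeries ℝ →ₗ[ℝ] Cohomology piSl2 0 :=
  cohomologyClass piSl2 0 ∘ₗ LinearMap.codRestrict (cocycles piSl2 0)
    { toFun := fun φ => ofFunction (substCasimir φ)
      map_add' := fun φ ψ => by rw [map_add, ofFunction_add]
      map_smul' := fun r φ => by rw [map_smul, ofFunction_smul]; rfl }
    ofFunction_subst_mem_cocycles

/-- The class of the volume trivector field times a series in the Casimir function. -/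
def casimirVolumeClass : PowerSeries ℝ →ₗ[ℝ] Cohomology piSl2 3 :=
  cohomologyClass piSl2 3 ∘ₗ LinearMap.codRestrict (cocycles piSl2 3)
    { toFun := fun φ => ofFunction (substCasimir φ) * volume3
      map_add' := fun φ ψ => by rw [map_add, ofFunction_add, add_mul]
      map_smul' := fun r φ => by
        rw [map_smul, ofFunction_smul, smul_mul_assoc]
        rfl }
    fun φ => ofFunction_mul_volume3 (substCasimir φ) ▸ trivectorField_mem_cocycles _

lemma cohomologyClass_eq_zero_iff {k : ℕ} (P : cocycles piSl2 k) :
    cohomologyClass piSl2 k P = 0 ↔ (P : Multivector 3) ∈ coboundaries piSl2 k :=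
  Submodule.Quotient.mk_eq_zero _

lemma cohomologyClass_surjective (k : ℕ) : Function.Surjective (cohomologyClass piSl2 k) :=
  Submodule.mkQ_surjective _

lemma casimirClass_bijective : Function.Bijective casimirClass := by
  constructor
  · refine (injective_iff_map_eq_zero casimirClass).mpr fun φ hφ => ?_
    have h := (cohomologyClass_eq_zero_iff _).mp hφ
    exact eq_zero_of_subst_eq_zero (eq_zero_of_ofFunction_eq_zero ((Submodule.mem_bot ℝ).mp h))
  · intro y
    obtain ⟨⟨P, hP⟩, rfl⟩ := cohomologyClass_surjective 0 y
    obtain ⟨φ, rfl⟩ := exists_eq_ofFunction_subst hP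
    exact ⟨φ, rfl⟩

lemma casimirVolumeClass_bijective : Function.Bijective casimirVolumeClass := by
  constructor
  · refine (injective_iff_map_eq_zero casimirVolumeClass).mpr fun φ hφ => ?_
    have h : ofFunction (PowerSeries.subst casimir φ) * volume3 ∈ coboundaries piSl2 3 :=
      (cohomologyClass_eq_zero_iff _).mp hφ
    rw [ofFunction_mul_volume3] at h
    exact eq_zero_of_trivectorField_subst_mem h
  · intro y
    obtain ⟨⟨P, hP⟩, rfl⟩ := cohomologyClass_surjective 3 y
    obtain ⟨a, rfl⟩ := exists_eq_trivectorField hP.1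
    obtain ⟨φ, u, rfl⟩ := exists_eq_subst_add_casimirOp a
    -- The series part of the coefficient represents the class, since the difference `-Ω u` gives a
    -- coboundary.
    refine ⟨φ, ?_⟩
    rw [← sub_eq_zero, casimirVolumeClass, LinearMap.comp_apply, ← map_sub,
      cohomologyClass_eq_zero_iff]
    have h : trivectorField (casimirOp (-u)) =
        ofFunction (PowerSeries.subst casimir φ) * volume3 -
          trivectorField (PowerSeries.subst casimir φ + casimirOp u) := by
      simp only [ofFunction_mul_volume3, trivectorField, ofFunction_add, map_neg, ofFunction_neg,
        mul_add, mul_neg]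
      abel
    have h' := trivectorField_casimirOp_mem (-u)
    rw [h] at h'
    exact h'

lemma subsingleton_cohomology {k : ℕ} (h : cocycles piSl2 k ≤ coboundaries piSl2 k) :
    Subsingleton (Cohomology piSl2 k) :=
  Submodule.Quotient.subsingleton_iff.mpr (Submodule.submoduleOf_eq_top.mpr h)

end FormalPoisson

end

open FormalPoisson in
theorem corollary4p4 :
    (∃ e : PowerSeries ℝ ≃ₗ[ℝ] Cohomology piSl2 0, ∀ g : PowerSeries ℝ,
      ∃ hg : ofFunction (PowerSeries.subst casimir g) ∈ cocycles piSl2 0,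
        e g = cohomologyClass piSl2 0 ⟨_, hg⟩) ∧
    Subsingleton (Cohomology piSl2 1) ∧
    Subsingleton (Cohomology piSl2 2) ∧
    (∃ e : PowerSeries ℝ ≃ₗ[ℝ] Cohomology piSl2 3, ∀ g : PowerSeries ℝ,
      ∃ hg : ofFunction (PowerSeries.subst casimir g) * volume3 ∈ cocycles piSl2 3,
        e g = cohomologyClass piSl2 3 ⟨_, hg⟩) :=
  ⟨⟨LinearEquiv.ofBijective casimirClass casimirClass_bijective,
      fun g => ⟨ofFunction_subst_mem_cocycles g, rfl⟩⟩,
    subsingleton_cohomology cocycles_one_le,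
    subsingleton_cohomology cocycles_two_le,
    ⟨LinearEquiv.ofBijective casimirVolumeClass casimirVolumeClass_bijective,
      fun g => ⟨ofFunction_mul_volume3 (PowerSeries.subst casimir g) ▸
        trivectorField_mem_cocycles _, rfl⟩⟩⟩
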